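/- Let $\mathbb H^n=\mathbb R^{2n}\times\mathbb R$ be the Heisenberg group with left-invariant fields $e_i=\partial_i-\tfrac12x^{i+n}\partial_{2n+1}$, $e_{i+n}=\partial_{i+n}+\tfrac12x^{i}\partial_{2n+1}$ $(1\le i\le n)$, $e_{2n+1}=\partial_{2n+1}$. Let $D=\mathrm{span}(e_1,\dots,e_{2n})$, let $\langle\cdot,\cdot\rangle$ be the left-invariant metric for which $e_1,\dots,e_{2n+1}$ are orthonormal, let $\overline\nabla$ be the connection with $\overline\nabla e_k=0$ for all $k$, and let $\overline T$ be its torsion, so that $\overline T(e_i,e_j)=-[e_i,e_j]$. A smooth embedded submanifold $N\subset\mathbb H^n$ of codimension $p$ is called non-horizontal if $TN+D=T\mathbb H^n$ along $N$. In that case let $TN^\perp$ be the orthogonal complement of $TN\cap D$ in $D$, so that $T\mathbb H^n=TN\oplus TN^\perp$ along $N$, and let $v\mapsto v^\top$ be the corresponding projection onto $TN$. For a local smooth section $\xi$ of $TN^\perp$ put $A_\xi(X)=-(\overline\nabla_X\xi)^\top$ for $X\in TN$. The mean curvature is $H_\xi=-\operatorname{trace}A_\xi$ and the mean torsion is $\sigma_\xi=f^{2n+1}(\overline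 T(\xi,f_{2n+1}))$, where $f_1,\dots,f_{2n+1}$ is an adapted basis with dual basis $f^1,\dots,f^{2n+1}$: $f_1,\dots,f_p$ and $f_{p+1},\dots,f_{2n}$ are orthonormal bases of $TN^\perp$ and of $TN\cap D$, and $f_{2n+1}=e_{2n+1}-\sum_{\alpha=1}^pA^\alpha f_\alpha$ is tangent to $N$. The non-horizontal submanifold $N$ is called minimal if $H+\sigma=0$ on $TN^\perp$. Let $M\subset\mathbb R^{2n}$ be a smooth embedded submanifold of codimension $p$ that is minimal in the Euclidean sense, i.e. for every local smooth normal field $\xi$ of $M$ the shape operator $X\mapsto-(D_X\xi)^\top$ has trace $0$. Then the vertical cylinder $$N=\{(x,t)\in\mathbb H^n: x\in M,\ t\in\mathbb R\}$$ is a non-horizontal submanifold of codimension $p$ of $\mathbb H^n$, and it is minimal: $H+\sigma=0$ on $TN^\perp$. -/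

import Mathlib

open scoped ContDiff

noncomputable section

/-! ## Submanifolds of a normed space and minimal submanifolds of Euclidean space -/

section Submanifold

variable {E : Type*} [NormedAddCommGroup E] [NormedSpace ℝ E]

/-- `M` is an (embedded) smooth submanifold of codimension `p` of `E`: locally it is the zero set
of a smooth submersion to `ℝ ^ p`. -/
def IsSubmanifold (p : ℕ) (M : Set E) : Prop :=
  ∀ x ∈ M, ∃ (U : Set E) (φ : E → EuclideanSpace ℝ (Fin p)),
    IsOpen U ∧ x ∈ U ∧ ContDiffOn ℝ ∞ φ U ∧
    (∀ y ∈ U, Function.Surjective (fderiv ℝ φ y)) ∧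
    M ∩ U = {y ∈ U | φ y = 0}

/-- The tangent space of `M` at `x`: the span of the velocities at `x` of the curves in `M`
through `x`. -/
def tangentSpaceAt (M : Set E) (x : E) : Submodule ℝ E :=
  Submodule.span ℝ
    {v | ∃ γ : ℝ → E, (∀ t, γ t ∈ M) ∧ γ 0 = x ∧ HasDerivAt γ v 0}

end Submanifold

section Euclidean

variable {ι : Type*} [Fintype ι]

/-- `ξ`, a smooth map on the open set `U`, restricts to a section over `M ∩ U` of the normal bundle
of `M` in Euclidean space. -/
def IsEuclideanNormalField (M U : Set (EuclideanSpace ℝ ι))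
    (ξ : EuclideanSpace ℝ ι → EuclideanSpace ℝ ι) : Prop :=
  ContDiffOn ℝ ∞ ξ U ∧ ∀ y ∈ M ∩ U, ξ y ∈ (tangentSpaceAt M y)ᗮ

/-- The shape operator `v ↦ - (D_v ξ)ᵀ` of `M` at `x` in Euclidean space. -/
def euclideanWeingarten (M : Set (EuclideanSpace ℝ ι))
    (ξ : EuclideanSpace ℝ ι → EuclideanSpace ℝ ι) (x : EuclideanSpace ℝ ι) :
    tangentSpaceAt M x →ₗ[ℝ] tangentSpaceAt M x :=
  -((tangentSpaceAt M x).orthogonalProjectionOnto.toLinearMap ∘ₗ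
      (fderiv ℝ ξ x).toLinearMap ∘ₗ (tangentSpaceAt M x).subtype)

/-- `M` is a minimal submanifold of codimension `p` of Euclidean space: a smooth submanifold all of
whose mean curvatures `tr A_ξ`, for `ξ` normal, vanish. -/
def IsEuclideanMinimal (p : ℕ) (M : Set (EuclideanSpace ℝ ι)) : Prop :=
  IsSubmanifold p M ∧
    ∀ x ∈ M, ∀ (U : Set (EuclideanSpace ℝ ι)) (ξ : EuclideanSpace ℝ ι → EuclideanSpace ℝ ι),
      IsOpen U → x ∈ U → IsEuclideanNormalField M U ξ →
      LinearMap.trace ℝ (tangentSpaceAt M x) (euclideanWeingarten M ξ x) = 0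

end Euclidean

/-! ## The Heisenberg group -/

/-- The underlying space `ℝ ^ {2n} × ℝ` of the Heisenberg group, in exponential coordinates. The
coordinates `x^i` and `x^{i+n}` of `ℝ ^ {2n}` are indexed by `Sum.inl i` and `Sum.inr i`. As the
space is a vector space, it is also used for all its tangent spaces `T_q ℍⁿ` (in the coordinate
basis `∂/∂x^k`). -/
abbrev Heis (n : ℕ) : Type := EuclideanSpace ℝ (Fin n ⊕ Fin n) × ℝ

namespace Heis

variable {n : ℕ}

/-- The symplectic form `∑ (x^i y^{i+n} - y^i x^{i+n})`. -/
def symp (x y : EuclideanSpace ℝ (Fin n ⊕ Fin n)) : ℝ :=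
  ∑ i : Fin n, (x (Sum.inl i) * y (Sum.inr i) - y (Sum.inl i) * x (Sum.inr i))

theorem symp_add_right (x y z : EuclideanSpace ℝ (Fin n ⊕ Fin n)) :
    symp x (y + z) = symp x y + symp x z := by
  simp only [symp, PiLp.add_apply, ← Finset.sum_add_distrib]
  exact Finset.sum_congr rfl fun i _ => by ring

theorem symp_smul_right (x : EuclideanSpace ℝ (Fin n ⊕ Fin n)) (c : ℝ)
    (y : EuclideanSpace ℝ (Fin n ⊕ Fin n)) : symp x (c • y) = c * symp x y := by
  simp only [symp, PiLp.smul_apply, smul_eq_mul, Finset.mul_sum]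
  exact Finset.sum_congr rfl fun i _ => by ring

theorem symp_swap (x y : EuclideanSpace ℝ (Fin n ⊕ Fin n)) : symp x y = -symp y x := by
  simp only [symp, ← Finset.sum_neg_distrib]
  exact Finset.sum_congr rfl fun i _ => by ring

theorem symp_self (x : EuclideanSpace ℝ (Fin n ⊕ Fin n)) : symp x x = 0 := by
  simp [symp]

/-- The group operation of the Heisenberg group. -/
def mul (q r : Heis n) : Heis n := (q.1 + r.1, q.2 + r.2 + (1 / 2) * symp q.1 r.1)

/-- The Heisenberg group is a group, with neutral element `0` and inverse `-q`. -/
@[reducible] def group (n : ℕ) : Group (Heis n) where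
  mul := mul
  one := 0
  inv q := -q
  mul_assoc a b c := by
    have h := symp_swap (a.1 + b.1) c.1
    rw [symp_add_right, symp_swap c.1 a.1, symp_swap c.1 b.1] at h
    refine Prod.ext (add_assoc _ _ _) ?_
    change a.2 + b.2 + 1 / 2 * symp a.1 b.1 + c.2 + 1 / 2 * symp (a.1 + b.1) c.1
      = a.2 + (b.2 + c.2 + 1 / 2 * symp b.1 c.1) + 1 / 2 * symp a.1 (b.1 + c.1)
    rw [h, symp_add_right]; ring
  one_mul a := by
    change mul 0 a = a
    simp [mul, symp]
  mul_one a := by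
    change mul a 0 = a
    simp [mul, symp]
  inv_mul_cancel a := by
    change mul (-a) a = 0
    have h : symp (-a.1) a.1 = 0 := by
      rw [symp_swap, ← neg_one_smul ℝ a.1, symp_smul_right, symp_self]; simp
    refine Prod.ext ?_ ?_ <;> simp [mul, h]

/-- The left trivialization `𝔥 = T_0 ℍⁿ ≃ T_q ℍⁿ`, `∑ u^k e_k ↦ ∑ u^k e_k(q)`, where
`e_i = ∂_i - (1/2) x^{i+n} ∂_{2n+1}`, `e_{i+n} = ∂_{i+n} + (1/2) x^i ∂_{2n+1}`,
`e_{2n+1} = ∂_{2n+1}` are the standard left-invariant fields. -/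
def leftTriv (q : Heis n) : Heis n ≃ₗ[ℝ] Heis n where
  toFun u := (u.1, u.2 + (1 / 2) * symp q.1 u.1)
  invFun v := (v.1, v.2 - (1 / 2) * symp q.1 v.1)
  map_add' u v := by
    refine Prod.ext rfl ?_
    simp only [Prod.fst_add, Prod.snd_add, symp_add_right]; ring
  map_smul' c u := by
    refine Prod.ext rfl ?_
    simp only [Prod.smul_fst, Prod.smul_snd, symp_smul_right, smul_eq_mul, RingHom.id_apply]; ring
  left_inv u := by simp
  right_inv v := by simp

/-- The left-invariant vector field on `ℍⁿ` with value `u` at `0`. -/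
def leftField (u : Heis n) (q : Heis n) : Heis n := leftTriv q u

/-- `leftTriv q` is the differential at `0` of the left translation by `q`. -/
theorem hasFDerivAt_mul (q : Heis n) :
    HasFDerivAt (mul q) (LinearMap.toContinuousLinearMap (leftTriv q).toLinearMap) 0 := by
  have h : mul q = fun r => q + LinearMap.toContinuousLinearMap (leftTriv q).toLinearMap r := by
    funext r
    refine Prod.ext rfl ?_
    change q.2 + r.2 + 1 / 2 * symp q.1 r.1 = q.2 + (r.2 + 1 / 2 * symp q.1 r.1)
    ring
  rw [h]
  exact (ContinuousLinearMap.hasFDerivAt _).const_add q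

/-- The unit vertical left-invariant field `e_{2n+1} = ∂_{2n+1}`. -/
def vert (q : Heis n) : Heis n := leftField (0, 1) q

/-- The horizontal distribution `D`, spanned by `e_1, …, e_{2n}`. -/
def horizontal (q : Heis n) : Submodule ℝ (Heis n) :=
  (LinearMap.ker (LinearMap.snd ℝ (EuclideanSpace ℝ (Fin n ⊕ Fin n)) ℝ)).map
    (leftTriv q).toLinearMap

/-- The left-invariant metric on `ℍⁿ` for which `e_1, …, e_{2n+1}` are orthonormal. -/
def metric (q u v : Heis n) : ℝ :=
  inner ℝ ((leftTriv q).symm u).1 ((leftTriv q).symm v).1 +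
    ((leftTriv q).symm u).2 * ((leftTriv q).symm v).2

/-- The covariant derivative on `T ℍⁿ` for which the left-invariant fields are parallel:
`∇_v Y = ∑ dY^k(v) e_k` for `Y = ∑ Y^k e_k`. -/
def nabla (Y : Heis n → Heis n) (q : Heis n) : Heis n →ₗ[ℝ] Heis n :=
  (leftTriv q).toLinearMap ∘ₗ
    (fderiv ℝ (fun r => (leftTriv r).symm (Y r)) q).toLinearMap

/-- The torsion `∇_X Y - ∇_Y X - [X, Y]` of `nabla`. -/
def torsionField (X Y : Heis n → Heis n) (q : Heis n) : Heis n :=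
  nabla Y q (X q) - nabla X q (Y q) - VectorField.lieBracket ℝ X Y q

/-- The torsion tensor at `q`, evaluated on tangent vectors through their left-invariant
extensions. -/
def torsion (q u v : Heis n) : Heis n :=
  torsionField (leftField ((leftTriv q).symm u)) (leftField ((leftTriv q).symm v)) q

/-! ### Linear algebra of the tangent space of a submanifold -/

/-- The horizontal normal space `T^⊥` of a subspace `T` of `T_q ℍⁿ`: the orthogonal complement of
`T ∩ D` in `D`. -/
def normalSpace (q : Heis n) (T : Submodule ℝ (Heis n)) : Submodule ℝ (Heis n) where
  carrier := {ξ | ξ ∈ horizontal q ∧ ∀ w ∈ T ⊓ horizontal q, metric q ξ w = 0}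
  add_mem' {a b} ha hb := by
    refine ⟨add_mem ha.1 hb.1, fun w hw => ?_⟩
    have h1 := ha.2 w hw
    have h2 := hb.2 w hw
    simp only [metric, map_add, Prod.fst_add, Prod.snd_add, inner_add_left] at h1 h2 ⊢
    linarith
  zero_mem' := ⟨zero_mem _, fun w _ => by simp [metric]⟩
  smul_mem' c a ha := by
    refine ⟨Submodule.smul_mem _ c ha.1, fun w hw => ?_⟩
    have h1 := ha.2 w hw
    simp only [metric, map_smul, Prod.smul_fst, Prod.smul_snd, real_inner_smul_left,
      smul_eq_mul] at h1 ⊢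
    linear_combination c * h1

theorem mem_horizontal {q u : Heis n} : u ∈ horizontal q ↔ ((leftTriv q).symm u).2 = 0 := by
  constructor
  · rintro ⟨v, hv, rfl⟩
    have h : (leftTriv q).symm ((leftTriv q).toLinearMap v) = v := (leftTriv q).symm_apply_apply v
    rw [h]
    exact hv
  · intro h
    exact ⟨(leftTriv q).symm u, h, (leftTriv q).apply_symm_apply u⟩

/-- If `T + D = T_q ℍⁿ`, then `T_q ℍⁿ = T ⊕ T^⊥`. -/
theorem isCompl_normalSpace {q : Heis n} {T : Submodule ℝ (Heis n)}
    (hT : T ⊔ horizontal q = ⊤) : IsCompl T (normalSpace q T) := by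
  constructor
  · rw [Submodule.disjoint_def]
    intro u hu hn
    have h0 := hn.2 u ⟨hu, hn.1⟩
    have h2 := mem_horizontal.1 hn.1
    simp only [metric, h2, mul_zero, add_zero, inner_self_eq_zero] at h0
    exact (leftTriv q).symm.map_eq_zero_iff.1 (Prod.ext h0 h2)
  · rw [codisjoint_iff, eq_top_iff, ← hT]
    refine sup_le le_sup_left fun d hd => ?_
    let K : Submodule ℝ (EuclideanSpace ℝ (Fin n ⊕ Fin n)) :=
      (T ⊓ horizontal q).map
        (LinearMap.fst ℝ (EuclideanSpace ℝ (Fin n ⊕ Fin n)) ℝ ∘ₗ (leftTriv q).symm.toLinearMap)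
    obtain ⟨w, hw, hwk⟩ := K.starProjection_apply_mem ((leftTriv q).symm d).1
    have key : d - w ∈ normalSpace q T := by
      refine ⟨sub_mem hd hw.2, fun w' hw' => ?_⟩
      have h2 := mem_horizontal.1 hw'.2
      have hperp := K.sub_starProjection_mem_orthogonal ((leftTriv q).symm d).1
      have h3 := (Submodule.mem_orthogonal' _ _).1 hperp _ ⟨w', hw', rfl⟩
      rw [← hwk] at h3
      simp only [metric, h2, mul_zero, add_zero, map_sub, Prod.fst_sub]
      exact h3
    have : d = w + (d - w) := by abel
    rw [this]
    exact Submodule.add_mem_sup hw.1 key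

/-- The projection `v ↦ vᵀ` of `T_q ℍⁿ = T ⊕ T^⊥` onto `T`. -/
def tangentialPart {q : Heis n} {T : Submodule ℝ (Heis n)} (hT : T ⊔ horizontal q = ⊤) :
    Heis n →ₗ[ℝ] T :=
  T.projectionOnto (normalSpace q T) (isCompl_normalSpace hT)

/-! ### Non-horizontal submanifolds -/

/-- `N` is a non-horizontal submanifold of codimension `p` of `ℍⁿ`: `T N + D = T ℍⁿ` along `N`. -/
structure IsNonHorizontal (p : ℕ) (N : Set (Heis n)) : Prop where
  isSubmanifold : IsSubmanifold p N
  sup_eq_top : ∀ q ∈ N, tangentSpaceAt N q ⊔ horizontal q = ⊤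

/-- `ξ`, a smooth vector field on the open set `U`, restricts to a section of `T N^⊥` over
`N ∩ U`. -/
def IsNormalField (N U : Set (Heis n)) (ξ : Heis n → Heis n) : Prop :=
  ContDiffOn ℝ ∞ ξ U ∧ ∀ r ∈ N ∩ U, ξ r ∈ normalSpace r (tangentSpaceAt N r)

/-- The Weingarten operator `A_ξ(X) = - (∇_X ξ)ᵀ` of `N` at `q`. -/
def weingarten {N : Set (Heis n)} {q : Heis n} (hq : tangentSpaceAt N q ⊔ horizontal q = ⊤)
    (ξ : Heis n → Heis n) : tangentSpaceAt N q →ₗ[ℝ] tangentSpaceAt N q :=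
  -(tangentialPart hq ∘ₗ nabla ξ q ∘ₗ (tangentSpaceAt N q).subtype)

/-- The mean curvature `H_ξ = - trace A_ξ` at `q`. -/
def meanCurvature {N : Set (Heis n)} {q : Heis n} (hq : tangentSpaceAt N q ⊔ horizontal q = ⊤)
    (ξ : Heis n → Heis n) : ℝ :=
  -LinearMap.trace ℝ (tangentSpaceAt N q) (weingarten hq ξ)

/-- The mean torsion `σ_ξ = f^{2n+1}(T(ξ, f_{2n+1}))` at `q`, for `ξ ∈ T_q N^⊥`. Here
`f_{2n+1}` is the element of an adapted basis that has the form `e_{2n+1} - ∑ A^α f_α` and is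
tangent to `N`, which means that it is the tangential part of `e_{2n+1}`; and `f^{2n+1}`, the
element of the dual basis, is `e^{2n+1}`. See `meanTorsion_eq_of_isAdaptedBasis`. -/
def meanTorsion {N : Set (Heis n)} {q : Heis n} (hq : tangentSpaceAt N q ⊔ horizontal q = ⊤)
    (ξ : Heis n) : ℝ :=
  ((leftTriv q).symm (torsion q ξ (tangentialPart hq (vert q)))).2

/-- Adapted bases at `q` of a subspace `T` of `T_q ℍⁿ`: `f_1, …, f_p` and `f_{p+1}, …, f_{2n}` are
orthonormal in `T^⊥` and in `T ∩ D`, and `f_{2n+1} = e_{2n+1} - ∑ A^α f_α` lies in `T`. -/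
structure IsAdaptedBasis (q : Heis n) (T : Submodule ℝ (Heis n)) {p k : ℕ}
    (f : Module.Basis ((Fin p ⊕ Fin k) ⊕ Unit) ℝ (Heis n)) : Prop where
  orthonormal : ∀ a b, metric q (f (Sum.inl a)) (f (Sum.inl b)) = if a = b then 1 else 0
  normal : ∀ α, f (Sum.inl (Sum.inl α)) ∈ normalSpace q T
  tangent : ∀ i, f (Sum.inl (Sum.inr i)) ∈ T ⊓ horizontal q
  last_mem : f (Sum.inr ()) ∈ T
  last_eq : ∃ A : Fin p → ℝ, f (Sum.inr ()) = vert q - ∑ α, A α • f (Sum.inl (Sum.inl α))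

/-- The mean torsion is `f^{2n+1}(T(ξ, f_{2n+1}))` in every adapted basis. -/
theorem meanTorsion_eq_of_isAdaptedBasis {N : Set (Heis n)} {q : Heis n}
    (hq : tangentSpaceAt N q ⊔ horizontal q = ⊤) {p k : ℕ}
    (f : Module.Basis ((Fin p ⊕ Fin k) ⊕ Unit) ℝ (Heis n))
    (hf : IsAdaptedBasis q (tangentSpaceAt N q) f) (ξ : Heis n) :
    meanTorsion hq ξ = f.coord (Sum.inr ()) (torsion q ξ (f (Sum.inr ()))) := by
  obtain ⟨A, hA⟩ := hf.last_eq
  have hsum : ∑ α, A α • f (Sum.inl (Sum.inl α)) ∈ normalSpace q (tangentSpaceAt N q) :=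
    Submodule.sum_mem _ fun α _ => Submodule.smul_mem _ _ (hf.normal α)
  have hlast : (tangentialPart hq (vert q) : Heis n) = f (Sum.inr ()) := by
    have hv : vert q = f (Sum.inr ()) + ∑ α, A α • f (Sum.inl (Sum.inl α)) := by rw [hA]; abel
    have h1 : tangentialPart hq (f (Sum.inr ())) = ⟨_, hf.last_mem⟩ :=
      Submodule.projectionOnto_apply_left (isCompl_normalSpace hq) ⟨_, hf.last_mem⟩
    have h2 : tangentialPart hq (∑ α, A α • f (Sum.inl (Sum.inl α))) = 0 :=
      Submodule.projectionOnto_apply_of_mem_right (isCompl_normalSpace hq) hsum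
    rw [hv, map_add, h1, h2, add_zero]
  have hcoord : f.coord (Sum.inr ()) =
      LinearMap.snd ℝ (EuclideanSpace ℝ (Fin n ⊕ Fin n)) ℝ ∘ₗ (leftTriv q).symm.toLinearMap := by
    refine f.ext fun i => ?_
    rcases i with (α | i) | ⟨⟩
    · have := mem_horizontal.1 (hf.normal α).1
      simp [this]
    · have := mem_horizontal.1 (hf.tangent i).2
      simp [this]
    · have h0 := mem_horizontal.1 hsum.1
      have h1 : ((leftTriv q).symm (vert q)).2 = 1 := by
        rw [vert, leftField, (leftTriv q).symm_apply_apply]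
      have : ((leftTriv q).symm (f (Sum.inr ()))).2 = 1 := by
        rw [hA, map_sub, Prod.snd_sub, h0, h1, sub_zero]
      simp [this]
  rw [meanTorsion, hlast, hcoord]
  rfl

/-- `N` is a minimal non-horizontal submanifold of codimension `p` of `ℍⁿ`: `H + σ = 0` on
`T N^⊥`. -/
def IsMinimal (p : ℕ) (N : Set (Heis n)) : Prop :=
  ∃ hN : IsNonHorizontal p N,
    ∀ (q : Heis n) (hq : q ∈ N) (U : Set (Heis n)) (ξ : Heis n → Heis n),
      IsOpen U → q ∈ U → IsNormalField N U ξ →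
      meanCurvature (hN.sup_eq_top q hq) ξ + meanTorsion (hN.sup_eq_top q hq) (ξ q) = 0

end Heis

end

/-! Both terms vanish separately. The field e_{2n+1} is tangent to N, so f_{2n+1} = e_{2n+1}; it
commutes with every left-invariant field, so its torsion with ξ is zero and σ = 0 (`torsion_vert`).

For H, T_qN is T_xM × ℝ, and forgetting the last coordinate identifies TN^⊥ with the Euclidean
normal space (`mem_normalSpace_cylinder`). In the left-invariant frame TN^⊥ is constant along
vertical lines, so the vertical derivative of ξ is again normal and A_ξ kills the vertical direction
(`nabla_vertical_mem_normalSpace`). Hence A_ξ factors through the projection T_qN → T_xM, and what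
it induces on T_xM is the Euclidean shape operator of the slice of ξ at the height of q. The traces
agree (`meanCurvature_cylinder`), so H = 0. -/

section Cylinder

variable {n p : ℕ} {M : Set (EuclideanSpace ℝ (Fin n ⊕ Fin n))}

/-- The preimage of a submanifold under a surjective continuous linear projection `E × F → E` is a
submanifold of the same codimension. -/
theorem IsSubmanifold.preimage_fst {E F : Type*} [NormedAddCommGroup E] [NormedSpace ℝ E]
    [NormedAddCommGroup F] [NormedSpace ℝ F] {p : ℕ} {M : Set E} (hM : IsSubmanifold p M) :
    IsSubmanifold p {q : E × F | q.1 ∈ M} := by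
  intro q hq
  obtain ⟨U, φ, hU, hqU, hφ, hsurj, hMU⟩ := hM q.1 hq
  refine ⟨Prod.fst ⁻¹' U, φ ∘ Prod.fst, hU.preimage continuous_fst, hqU,
    hφ.comp contDiff_fst.contDiffOn fun y hy => hy, fun y hy => ?_, ?_⟩
  · have hd : DifferentiableAt ℝ φ y.1 :=
      (hφ.contDiffAt (hU.mem_nhds hy)).differentiableAt (by simp)
    rw [(hd.hasFDerivAt.comp y hasFDerivAt_fst).fderiv]
    exact (hsurj y.1 hy).comp Prod.fst_surjective
  · ext y
    exact Set.ext_iff.1 hMU y.1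

/-- The tangent space of the cylinder `M × F` is `T M × F`. -/
theorem mem_tangentSpaceAt_preimage_fst {E F : Type*} [NormedAddCommGroup E] [NormedSpace ℝ E]
    [NormedAddCommGroup F] [NormedSpace ℝ F] {M : Set E} {q : E × F} (hq : q.1 ∈ M) {v : E × F} :
    v ∈ tangentSpaceAt {r : E × F | r.1 ∈ M} q ↔ v.1 ∈ tangentSpaceAt M q.1 := by
  constructor
  · intro hv
    have hle : tangentSpaceAt {r : E × F | r.1 ∈ M} q ≤
        (tangentSpaceAt M q.1).comap (LinearMap.fst ℝ E F) := by
      refine Submodule.span_le.2 ?_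
      rintro w ⟨γ, hγ, h0, hd⟩
      exact Submodule.subset_span ⟨fun t => (γ t).1, hγ, by simp [h0], hd.fst⟩
    exact hle hv
  · intro hv
    have hle : tangentSpaceAt M q.1 ≤
        (tangentSpaceAt {r : E × F | r.1 ∈ M} q).comap (LinearMap.inl ℝ E F) := by
      refine Submodule.span_le.2 ?_
      rintro w ⟨γ, hγ, h0, hd⟩
      exact Submodule.subset_span ⟨fun t => (γ t, q.2), hγ, by simp [h0],
        hd.prodMk (hasDerivAt_const _ _)⟩
    have h2 : ((0 : E), v.2) ∈ tangentSpaceAt {r : E × F | r.1 ∈ M} q := by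
      refine Submodule.subset_span ⟨fun t => (q.1, q.2 + t • v.2), fun _ => hq, by simp, ?_⟩
      refine (hasDerivAt_const _ _).prodMk ?_
      simpa using ((hasDerivAt_id (0 : ℝ)).smul_const v.2).const_add q.2
    have h : v = (v.1, (0 : F)) + ((0 : E), v.2) := by simp
    rw [h]
    exact add_mem (hle hv) h2

/-! ### Left-invariant frame and torsion -/

namespace Heis

theorem leftTriv_symm_apply (q v : Heis n) :
    (leftTriv q).symm v = (v.1, v.2 - (1 / 2) * symp q.1 v.1) := rfl

theorem leftTriv_apply (q u : Heis n) :
    leftTriv q u = (u.1, u.2 + (1 / 2) * symp q.1 u.1) := rfl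

theorem vert_eq (q : Heis n) : vert q = (0, 1) := by
  simp [vert, leftField, leftTriv_apply, symp]

theorem differentiable_leftField (u : Heis n) : Differentiable ℝ (leftField u) := by
  unfold leftField
  simp only [leftTriv_apply, symp]
  fun_prop

theorem differentiableAt_leftTriv_symm {Y : Heis n → Heis n} {q : Heis n}
    (hY : DifferentiableAt ℝ Y q) :
    DifferentiableAt ℝ (fun r => (leftTriv r).symm (Y r)) q := by
  simp only [leftTriv_symm_apply, symp]
  fun_prop

/-- The frame coefficients are constant. The torsion of left-invariant fields therefore reduces to
minus their Lie bracket. -/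
theorem nabla_leftField (u q : Heis n) : nabla (leftField u) q = 0 := by
  have h : (fun r => (leftTriv r).symm (leftField u r)) = fun _ => u := by
    funext r
    exact (leftTriv r).symm_apply_apply u
  ext v <;> simp [nabla, h]

/-- The vertical direction is in the kernel of the torsion. -/
theorem torsion_vert (q u : Heis n) : torsion q u (vert q) = 0 := by
  have hv : (leftTriv q).symm (vert q) = (0, 1) := (leftTriv q).symm_apply_apply _
  have hc : leftField (0, 1) = fun _ : Heis n => ((0, 1) : Heis n) := by
    funext r
    exact vert_eq r
  have hd : ∀ w : Heis n, fderiv ℝ (leftField w) q (0, 1) = 0 := by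
    intro w
    have h1 := (differentiable_leftField w q).hasFDerivAt.comp_hasDerivAt_of_eq (0 : ℝ)
      (f := fun t : ℝ => q + t • ((0, 1) : Heis n))
      (by simpa using ((hasDerivAt_id (0 : ℝ)).smul_const ((0, 1) : Heis n)).const_add q)
      (by simp)
    -- The coefficients of a left-invariant field do not involve the last coordinate.
    have h2 : leftField w ∘ (fun t : ℝ => q + t • ((0, 1) : Heis n)) =
        fun _ => leftField w q := by
      funext t
      simp [leftField, leftTriv_apply]
    rw [h2] at h1
    exact h1.unique (hasDerivAt_const _ _)
  rw [torsion, torsionField, hv, nabla_leftField, nabla_leftField, VectorField.lieBracket]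
  have h0 : leftField (0, 1) q = ((0, 1) : Heis n) := vert_eq q
  rw [h0, hd, hc]
  simp

theorem meanTorsion_eq_zero_of_vert_mem {N : Set (Heis n)} {q : Heis n}
    (hq : tangentSpaceAt N q ⊔ horizontal q = ⊤) (hv : vert q ∈ tangentSpaceAt N q)
    (ξ : Heis n) : meanTorsion hq ξ = 0 := by
  have h : tangentialPart hq (vert q) = ⟨vert q, hv⟩ :=
    Submodule.projectionOnto_apply_left (isCompl_normalSpace hq) ⟨_, hv⟩
  rw [meanTorsion, h, torsion_vert]
  simp

/-! ### Tangent and normal spaces of the cylinder -/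

/-- The horizontal normal space of the cylinder over `M` is the horizontal lift of the Euclidean
normal space of `M`. -/
theorem mem_normalSpace_cylinder {q : Heis n} (hq : q.1 ∈ M) {ξ : Heis n} :
    ξ ∈ normalSpace q (tangentSpaceAt {r : Heis n | r.1 ∈ M} q) ↔
      ((leftTriv q).symm ξ).2 = 0 ∧ ξ.1 ∈ (tangentSpaceAt M q.1)ᗮ := by
  constructor
  · rintro ⟨h1, h2⟩
    refine ⟨mem_horizontal.1 h1, (Submodule.mem_orthogonal' _ _).2 fun v hv => ?_⟩
    -- Test against the horizontal lift of v.
    have h := h2 (leftTriv q (v, 0))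
      ⟨(mem_tangentSpaceAt_preimage_fst hq).2 hv, mem_horizontal.2 (by simp)⟩
    simpa [metric, leftTriv_symm_apply] using h
  · rintro ⟨h1, h2⟩
    refine ⟨mem_horizontal.2 h1, fun w hw => ?_⟩
    have h := (Submodule.mem_orthogonal' _ _).1 h2 w.1
      ((mem_tangentSpaceAt_preimage_fst hq).1 hw.1)
    rw [metric, h1, zero_mul, add_zero]
    exact h

/-- The vertical line is tangent to the cylinder and already complements D. -/
theorem isNonHorizontal_cylinder (hM : IsSubmanifold p M) :
    IsNonHorizontal p {q : Heis n | q.1 ∈ M} where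
  isSubmanifold := hM.preimage_fst
  sup_eq_top q hq := by
    refine eq_top_iff.2 fun v _ => ?_
    have h : v = ((0, ((leftTriv q).symm v).2) : Heis n) + leftTriv q (v.1, 0) := by
      simp [leftTriv_symm_apply, leftTriv_apply]
    rw [h]
    exact Submodule.add_mem_sup ((mem_tangentSpaceAt_preimage_fst hq).2 (zero_mem _))
      (mem_horizontal.2 (by simp))

/-- The splitting TN ⊕ TN^⊥ is not orthogonal for a Euclidean metric on ℝ^{2n+1}, but its first
components are: v - vᵀ lies in TN^⊥, so its ℝ^{2n} part is orthogonal to T_xM. -/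
theorem tangentialPart_cylinder_fst {q : Heis n} (hq : q.1 ∈ M)
    (hT : tangentSpaceAt {r : Heis n | r.1 ∈ M} q ⊔ horizontal q = ⊤) (v : Heis n) :
    (tangentialPart hT v : Heis n).1 =
      ((tangentSpaceAt M q.1).orthogonalProjectionOnto v.1 :
        EuclideanSpace ℝ (Fin n ⊕ Fin n)) := by
  refine (Submodule.eq_starProjection_of_mem_orthogonal
    ((mem_tangentSpaceAt_preimage_fst hq).1 (tangentialPart hT v).2) ?_).symm
  have h0 : tangentialPart hT (v - tangentialPart hT v) = 0 := by
    rw [map_sub, sub_eq_zero]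
    exact (Submodule.projectionOnto_apply_left (isCompl_normalSpace hT) _).symm
  have h : v - tangentialPart hT v ∈ normalSpace q (tangentSpaceAt {r : Heis n | r.1 ∈ M} q) :=
    (Submodule.projectionOnto_apply_eq_zero_iff (isCompl_normalSpace hT)).1 h0
  exact ((mem_normalSpace_cylinder hq).1 h).2

/-! ### Weingarten operator and mean curvature of the cylinder -/

theorem nabla_apply_fst {Y : Heis n → Heis n} {q : Heis n} (hY : DifferentiableAt ℝ Y q)
    (v : Heis n) : (nabla Y q v).1 = (fderiv ℝ Y q v).1 := by
  have h1 := (differentiableAt_leftTriv_symm hY).hasFDerivAt.fst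
  exact congrArg (fun L => L v) (h1.unique hY.hasFDerivAt.fst)

/-- The covariant derivative in the vertical direction of a normal field of a cylinder is
normal. -/
theorem nabla_vertical_mem_normalSpace {q : Heis n} (hq : q.1 ∈ M) {U : Set (Heis n)}
    (hU : IsOpen U) (hqU : q ∈ U) {ξ : Heis n → Heis n}
    (hξ : IsNormalField {r : Heis n | r.1 ∈ M} U ξ) (c : ℝ) :
    nabla ξ q (0, c) ∈ normalSpace q (tangentSpaceAt {r : Heis n | r.1 ∈ M} q) := by
  have hd : DifferentiableAt ℝ ξ q :=
    (hξ.1.contDiffAt (hU.mem_nhds hqU)).differentiableAt (by simp)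
  -- The normal space in frame coordinates; it is the same at every point of the vertical line
  -- through q.
  let S : Submodule ℝ (Heis n) := (tangentSpaceAt M q.1)ᗮ.prod ⊥
  let γ : ℝ → Heis n := fun t => q + t • ((0, c) : Heis n)
  have hγ : HasDerivAt γ (0, c) 0 := by
    have h := ((hasDerivAt_id (0 : ℝ)).smul_const ((0, c) : Heis n)).const_add q
    rwa [one_smul] at h
  have hγ0 : γ 0 = q := by simp [γ]
  have hder := (differentiableAt_leftTriv_symm hd).hasFDerivAt.comp_hasDerivAt_of_eq (0 : ℝ) hγ
    hγ0.symm
  have hmem : ∀ᶠ t in nhds (0 : ℝ), (leftTriv (γ t)).symm (ξ (γ t)) ∈ S := by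
    have h := hγ.continuousAt.preimage_mem_nhds (hU.mem_nhds (hγ0.symm ▸ hqU))
    filter_upwards [h] with t ht
    have hγt : (γ t).1 = q.1 := by simp [γ]
    have hM : (γ t).1 ∈ M := hγt ▸ hq
    have h2 := (mem_normalSpace_cylinder hM).1 (hξ.2 (γ t) ⟨hM, ht⟩)
    rw [hγt] at h2
    exact ⟨h2.2, h2.1⟩
  -- Difference quotients of a curve in S lie in S, which is closed.
  have hS : fderiv ℝ (fun r => (leftTriv r).symm (ξ r)) q (0, c) ∈ S := by
    refine S.closed_of_finiteDimensional.mem_of_tendsto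
      (hasDerivAt_iff_tendsto_slope.1 hder) ?_
    filter_upwards [hmem.filter_mono nhdsWithin_le_nhds] with t ht
    exact S.smul_mem _ (S.sub_mem ht hmem.self_of_nhds)
  refine (mem_normalSpace_cylinder hq).2 ⟨?_, hS.1⟩
  rw [nabla, LinearMap.comp_apply]
  erw [(leftTriv q).symm_apply_apply]
  exact hS.2

/-- A normal field of the cylinder restricts to a Euclidean normal field on each horizontal
slice. -/
theorem IsNormalField.slice {U : Set (Heis n)} {ξ : Heis n → Heis n}
    (hξ : IsNormalField {r : Heis n | r.1 ∈ M} U ξ) (t : ℝ) :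
    IsEuclideanNormalField M ((fun x => (x, t)) ⁻¹' U) fun x => (ξ (x, t)).1 := by
  refine ⟨?_, fun y hy => ((mem_normalSpace_cylinder (q := (y, t)) hy.1).1 (hξ.2 _ hy)).2⟩
  exact contDiff_fst.comp_contDiffOn
    (hξ.1.comp (contDiff_id.prodMk contDiff_const).contDiffOn fun x hx => hx)

/-- The mean curvature of a cylinder is the Euclidean mean curvature of its base. -/
theorem meanCurvature_cylinder {q : Heis n} (hq : q.1 ∈ M)
    (hT : tangentSpaceAt {r : Heis n | r.1 ∈ M} q ⊔ horizontal q = ⊤) {U : Set (Heis n)}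
    (hU : IsOpen U) (hqU : q ∈ U) {ξ : Heis n → Heis n}
    (hξ : IsNormalField {r : Heis n | r.1 ∈ M} U ξ) :
    meanCurvature hT ξ = -LinearMap.trace ℝ (tangentSpaceAt M q.1)
      (euclideanWeingarten M (fun x => (ξ (x, q.2)).1) q.1) := by
  have hd : DifferentiableAt ℝ ξ q :=
    (hξ.1.contDiffAt (hU.mem_nhds hqU)).differentiableAt (by simp)
  let P : tangentSpaceAt {r : Heis n | r.1 ∈ M} q →ₗ[ℝ] tangentSpaceAt M q.1 :=
    (LinearMap.fst ℝ _ ℝ).restrict fun _ hv => (mem_tangentSpaceAt_preimage_fst hq).1 hv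
  let i : tangentSpaceAt M q.1 →ₗ[ℝ] tangentSpaceAt {r : Heis n | r.1 ∈ M} q :=
    (LinearMap.inl ℝ _ ℝ).restrict fun _ hv => (mem_tangentSpaceAt_preimage_fst hq).2 hv
  have hA : weingarten hT ξ = (weingarten hT ξ ∘ₗ i) ∘ₗ P := by
    refine LinearMap.ext fun v => sub_eq_zero.1 ?_
    -- The difference is vertical, so its covariant derivative of ξ is normal and projects to zero.
    have hv : ((v - i (P v) : tangentSpaceAt {r : Heis n | r.1 ∈ M} q) : Heis n) =
        (0, (v : Heis n).2) := by
      exact Prod.ext (sub_self _) (sub_zero _)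
    change weingarten hT ξ v - weingarten hT ξ (i (P v)) = 0
    rw [← map_sub, weingarten, LinearMap.neg_apply, neg_eq_zero, LinearMap.comp_apply,
      LinearMap.comp_apply, Submodule.subtype_apply, hv]
    exact Submodule.projectionOnto_apply_of_mem_right (isCompl_normalSpace hT)
      (nabla_vertical_mem_normalSpace hq hU hqU hξ _)
  have hB : P ∘ₗ (weingarten hT ξ ∘ₗ i) =
      euclideanWeingarten M (fun x => (ξ (x, q.2)).1) q.1 := by
    refine LinearMap.ext fun v => Subtype.ext ?_
    have hslice : HasFDerivAt (fun x => (ξ (x, q.2)).1)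
        (((ContinuousLinearMap.fst ℝ _ ℝ).comp (fderiv ℝ ξ q)).comp
          (ContinuousLinearMap.inl ℝ _ ℝ)) q.1 :=
      HasFDerivAt.comp (g := fun r => (ξ r).1) q.1 hd.hasFDerivAt.fst
        (hasFDerivAt_prodMk_left q.1 q.2)
    change (-(tangentialPart hT (nabla ξ q ((v : EuclideanSpace ℝ (Fin n ⊕ Fin n)), 0)) :
      Heis n)).1 = -((tangentSpaceAt M q.1).orthogonalProjectionOnto
        (fderiv ℝ (fun x => (ξ (x, q.2)).1) q.1 v) : EuclideanSpace ℝ (Fin n ⊕ Fin n))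
    rw [hslice.fderiv, Prod.fst_neg, tangentialPart_cylinder_fst hq, nabla_apply_fst hd]
    rfl
  -- Cyclicity, tr((A i) P) = tr(P (A i)), moves the trace from T_qN to T_xM.
  rw [meanCurvature, hA, LinearMap.trace_comp_comm', hB]

end Heis

end Cylinder

/-- If `M` is a minimal submanifold of codimension `p` of `ℝ ^ {2n}`, then the vertical cylinder
`N = {(x, t) : x ∈ M, t ∈ ℝ}` is a minimal non-horizontal submanifold of codimension `p` of the
Heisenberg group `ℍⁿ`. -/
theorem mainTheorem8 (n p : ℕ) (M : Set (EuclideanSpace ℝ (Fin n ⊕ Fin n)))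
    (hM : IsEuclideanMinimal p M) :
    Heis.IsMinimal p {q : Heis n | q.1 ∈ M} := by
  refine ⟨Heis.isNonHorizontal_cylinder hM.1, fun q hq U ξ hU hqU hξ => ?_⟩
  have hv : Heis.vert q ∈ tangentSpaceAt {q : Heis n | q.1 ∈ M} q := by
    rw [Heis.vert_eq]
    exact (mem_tangentSpaceAt_preimage_fst hq).2 (zero_mem _)
  rw [Heis.meanTorsion_eq_zero_of_vert_mem _ hv, Heis.meanCurvature_cylinder (M := M) hq _ hU hqU hξ,
    hM.2 q.1 hq _ _ (hU.preimage (Continuous.prodMk_left q.2)) hqU (hξ.slice q.2)]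
  simp
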